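/- Let $\mathcal H=\bigotimes_{i=1}^m\mathcal H_i$ with complex Hilbert spaces $\mathcal H_i$ of finite dimension $d_i$, and let $S$ be a set of pairwise orthogonal pure product states (tensor products of local unit vectors) in $\mathcal H$. A set of orthogonal product states is called completable in a multipartite space if it is contained in a set of pairwise orthogonal pure product states that spans that space. A local protocol with classical communication is a finite adaptive tree of measurements: at each stage, depending on all outcomes so far (which are broadcast), one party $i$ measures its own system with finitely many outcomes $k$ and local measurement operators $M_k$, outcome $k$ sending the unnormalized state $\psi$ to $(M_k\otimes 1)\psi$; the probability of a complete record of outcomes is the squared norm of the final unnormalized vector. The set $S$ is exactly measurable by the protocol if there is a rule that assigns a state to every record such that, for each $\psi\in S$, every record that has nonzero probability on $\psi$ is assigned $\psi$. In a protocol of local von Neumann measurements, each measurement of party $i$ is given by a decomposition of the subspace of $\mathcal H_i$ that remains at that stage (initially $\mathcal H_i$) into mutually orthogonal subspaces: the $M_k$ are the orthogonal projections onto these subspaces, and after outcome $k$ the $k$-th subspace is the remaining space of party $i$. In a protocol of local POVMs, the $M_k$ are arbitrary operators on $\mathcal H_i$ with $\sum_k M_k^\dagger M_k=1$. 1. If $S$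 is exactly measurable by a protocol of local von Neumann measurements and classical communication, then $S$ is completable in $\mathcal H$. 2. If $S$ is exactly measurable by a protocol of local POVMs and classical communication, then there are finite-dimensional Hilbert spaces $\mathcal H_i'$ (possibly zero) such that $S$, regarded as a set of states in $\mathcal H'=\bigotimes_{i=1}^m(\mathcal H_i\oplus\mathcal H_i')$ through the canonical inclusions $\mathcal H_i\subseteq\mathcal H_i\oplus\mathcal H_i'$, is completable in $\mathcal H'$. -/

import Mathlib

open scoped Matrix

noncomputable section

namespace LocalMeasurement

/-- The Hilbert space `⨂ i, ℋ i`, where `ℋ i = EuclideanSpace ℂ (κ i)`: amplitudes indexed by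
tuples of local basis labels, with the `ℓ²` inner product. -/
abbrev Joint {ι : Type} [Fintype ι] (κ : ι → Type) [∀ i, Fintype (κ i)] : Type :=
  EuclideanSpace ℂ (∀ i, κ i)

/-- The product vector `⨂ i, φ i`. -/
def tensor {ι : Type} [Fintype ι] {κ : ι → Type} [∀ i, Fintype (κ i)]
    (φ : ∀ i, EuclideanSpace ℂ (κ i)) : EuclideanSpace ℂ (∀ i, κ i) :=
  WithLp.toLp 2 fun x => ∏ i, φ i (x i)

/-- A pure product state: a tensor product of local unit vectors. -/
def IsProductState {ι : Type} [Fintype ι] {κ : ι → Type} [∀ i, Fintype (κ i)]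
    (ψ : Joint κ) : Prop :=
  ∃ φ : ∀ i, EuclideanSpace ℂ (κ i), (∀ i, ‖φ i‖ = 1) ∧ ψ = tensor φ

/-- A set of pairwise orthogonal pure product states. -/
def IsOrthogonalProductSet {ι : Type} [Fintype ι] [DecidableEq ι] {κ : ι → Type}
    [∀ i, Fintype (κ i)] (S : Set (Joint κ)) : Prop :=
  (∀ ψ ∈ S, IsProductState ψ) ∧ S.Pairwise fun ψ χ => inner ℂ ψ χ = 0

/-- `S` can be completed to a full orthogonal product basis of the whole space. -/
def IsCompletable {ι : Type} [Fintype ι] [DecidableEq ι] {κ : ι → Type}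
    [∀ i, Fintype (κ i)] (S : Set (Joint κ)) : Prop :=
  ∃ B : Set (Joint κ), S ⊆ B ∧ IsOrthogonalProductSet B ∧ Submodule.span ℂ B = ⊤

/-- The canonical inclusion `⨂ i, ℋ i → ⨂ i, (ℋ i ⊕ ℋ' i)`, where `ℋ' i` has the basis labels
`κ' i`: the amplitude is copied on tuples of labels of the `ℋ i` and is zero on all others. -/
def extend {ι : Type} [Fintype ι] {κ κ' : ι → Type} [∀ i, Fintype (κ i)] [∀ i, Fintype (κ' i)]
    (ψ : Joint κ) : Joint (fun i => κ i ⊕ κ' i) :=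
  WithLp.toLp 2 fun x =>
    if h : ∀ i, (x i).isLeft then ψ fun i => (x i).getLeft (h i) else 0

/-- The operator `A` on `ℋ i`, tensored with the identity of all other parties, applied to `ψ`. -/
def applyLocal {ι : Type} [Fintype ι] [DecidableEq ι] {κ : ι → Type} [∀ i, Fintype (κ i)]
    (i : ι) (A : Matrix (κ i) (κ i) ℂ) (ψ : Joint κ) : Joint κ :=
  WithLp.toLp 2 fun x => ∑ y : κ i, A (x i) y * ψ (Function.update x i y)

/-- A finite adaptive protocol of local measurements with classical communication.  Either the
parties are done, or party `i` performs a measurement with `n` outcomes and measurement operators `M k`,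
the outcome is broadcast, and the protocol continues with `next k`. -/
inductive Protocol {ι : Type} (κ : ι → Type) : Type
  | done : Protocol κ
  | measure (i : ι) (n : ℕ) (M : Fin n → Matrix (κ i) (κ i) ℂ) (next : Fin n → Protocol κ) :
      Protocol κ

/-- The complete classical records (sequences of outcomes) of a protocol. -/
def Protocol.Record {ι : Type} {κ : ι → Type} : Protocol κ → Type
  | .done => Unit
  | .measure _ n _ next => Σ k : Fin n, (next k).Record

/-- The unnormalized state obtained from `ψ` when the record `b` is observed. -/
def Protocol.run {ι : Type} [Fintype ι] [DecidableEq ι] {κ : ι → Type} [∀ i, Fintype (κ i)] :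
    (T : Protocol κ) → T.Record → Joint κ → Joint κ
  | .done, _, ψ => ψ
  | .measure i _ M next, ⟨k, b⟩, ψ => (next k).run b (applyLocal i (M k) ψ)

/-- The probability of the record `b` on the initial state `ψ`. -/
def Protocol.prob {ι : Type} [Fintype ι] [DecidableEq ι] {κ : ι → Type} [∀ i, Fintype (κ i)]
    (T : Protocol κ) (b : T.Record) (ψ : Joint κ) : ℝ :=
  ‖T.run b ψ‖ ^ 2

/-- Every measurement is a POVM with elements `(M k)ᴴ * M k` and post-measurement states
proportional to `M k` applied to the state, with no other restriction on the operators `M k`. -/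
def Protocol.IsPOVM {ι : Type} {κ : ι → Type} [∀ i, Fintype (κ i)] [∀ i, DecidableEq (κ i)] :
    Protocol κ → Prop
  | .done => True
  | .measure _ _ M next => ∑ k, (M k)ᴴ * M k = 1 ∧ ∀ k, (next k).IsPOVM

/-- Every measurement is a von Neumann measurement on the remaining local space.  Here `P i` is the
orthogonal projection onto the subspace of `ℋ i` that remains at the current stage; the
measurement of party `i` is given by a decomposition of this subspace into mutually orthogonal
subspaces, with orthogonal projections `M k`, and after outcome `k` the range of `M k` is the
remaining space of party `i`. -/
def Protocol.IsVonNeumann {ι : Type} [DecidableEq ι] {κ : ι → Type} [∀ i, Fintype (κ i)]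
    [∀ i, DecidableEq (κ i)] : Protocol κ → (∀ i, Matrix (κ i) (κ i) ℂ) → Prop
  | .done, _ => True
  | .measure i _ M next, P =>
      (∀ k, (M k).IsHermitian ∧ M k * M k = M k) ∧ (∀ k l, k ≠ l → M k * M l = 0) ∧
        ∑ k, M k = P i ∧ ∀ k, (next k).IsVonNeumann (Function.update P i (M k))

/-- The protocol identifies the members of `S` exactly: the parties can name a state from the
classical record, and this is the actual state whenever the record has nonzero probability. -/
def Protocol.Distinguishes {ι : Type} [Fintype ι] [DecidableEq ι] {κ : ι → Type}
    [∀ i, Fintype (κ i)] (T : Protocol κ) (S : Set (Joint κ)) : Prop :=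
  ∃ guess : T.Record → Joint κ, ∀ ψ ∈ S, ∀ b, T.prob b ψ ≠ 0 → guess b = ψ

/-- `S` is exactly measurable by local von Neumann measurements and classical communication. -/
def MeasurableByVonNeumann {ι : Type} [Fintype ι] [DecidableEq ι] {κ : ι → Type}
    [∀ i, Fintype (κ i)] [∀ i, DecidableEq (κ i)] (S : Set (Joint κ)) : Prop :=
  ∃ T : Protocol κ, T.IsVonNeumann (fun _ => 1) ∧ T.Distinguishes S

/-- `S` is exactly measurable by local POVMs and classical communication. -/
def MeasurableByPOVM {ι : Type} [Fintype ι] [DecidableEq ι] {κ : ι → Type}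
    [∀ i, Fintype (κ i)] [∀ i, DecidableEq (κ i)] (S : Set (Joint κ)) : Prop :=
  ∃ T : Protocol κ, T.IsPOVM ∧ T.Distinguishes S

end LocalMeasurement

end

/-! ### Projections onto lines, and the cone of their finite sums. -/

noncomputable section

namespace LocalMeasurement

/-! Completability is recast as a statement about operators. If the projections onto the lines of
`S`, together with finitely many further projections onto product lines, sum to the identity, then
the unit vectors involved form an orthonormal basis by Parseval (`span_eq_top_and_inner_eq_zero`).
So it suffices that `1 - ∑ lineProj ψ` lies in the cone `productLineSums`; orthogonality never has
to be tracked while the extra vectors are built.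

For von Neumann protocols this is proved by induction on the tree
(`Protocol.IsVonNeumann.sub_sum_mem`), for any product projection `P` and any product vectors in its
range that the protocol separates. At a leaf at most one vector is nonzero, and it extends to a
product basis. At a measurement the branches give `∑ k, (P_k - ∑ s, L_{k,s})`, where `L_{k,s}`
projects onto the line of the `k`-th part of vector `s`. Recombining the parts of one vector costs
`∑ k, L_{k,s} - L_s`, which is again in the cone, since only one tensor factor changes and there the
difference is a projection.

For POVMs, Naimark dilation (`IsFrame.exists_dilation`) replaces each measurement by a projective
one on a larger local space. Enough spare dimension is reserved at the start for the whole tree, so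
the extended states are measured by a von Neumann protocol and the first part applies. -/

/-- The orthogonal projection onto the line spanned by `v` (zero if `v = 0`). -/
def lineProj {n : Type*} [Fintype n] (v : n → ℂ) : Matrix n n ℂ :=
  (star v ⬝ᵥ v)⁻¹ • Matrix.vecMulVec v (star v)

theorem lineProj_zero {n : Type*} [Fintype n] : lineProj (0 : n → ℂ) = 0 := by simp [lineProj]

theorem lineProj_apply {n : Type*} [Fintype n] (v : n → ℂ) (a b : n) :
    lineProj v a b = (star v ⬝ᵥ v)⁻¹ * (v a * star (v b)) := by
  simp [lineProj, Matrix.vecMulVec_apply]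

theorem lineProj_smul {n : Type*} [Fintype n] {c : ℂ} (hc : c ≠ 0) (v : n → ℂ) :
    lineProj (c • v) = lineProj v := by
  have hc' : (starRingEnd ℂ) c ≠ 0 := by simpa using hc
  ext a b
  simp only [lineProj_apply, star_smul, smul_dotProduct, dotProduct_smul, smul_eq_mul, Pi.smul_apply,
    star_mul', RCLike.star_def]
  field_simp

theorem star_dotProduct_self_ofReal {n : Type*} [Fintype n] (v : n → ℂ) :
    star (star v ⬝ᵥ v) = star v ⬝ᵥ v :=
  (Matrix.star_dotProduct v v).symm

theorem mul_lineProj {n : Type*} [Fintype n] {A : Matrix n n ℂ} {v : n → ℂ} (h : A *ᵥ v = v) :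
    A * lineProj v = lineProj v := by
  rw [lineProj, Matrix.mul_smul, Matrix.mul_vecMulVec, h]

open scoped ComplexOrder in
theorem lineProj_mulVec_self {n : Type*} [Fintype n] (v : n → ℂ) : lineProj v *ᵥ v = v := by
  by_cases hv : v = 0
  · simp [hv]
  have : star v ⬝ᵥ v ≠ 0 := mt dotProduct_star_self_eq_zero.1 hv
  rw [lineProj, Matrix.smul_mulVec, Matrix.vecMulVec_mulVec]
  ext a
  simp
  field_simp

theorem isStarProjection_lineProj {n : Type*} [Fintype n] (v : n → ℂ) :
    IsStarProjection (lineProj v) where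
  isIdempotentElem := mul_lineProj (lineProj_mulVec_self v)
  isSelfAdjoint := by
    ext a b
    rw [Matrix.star_apply, lineProj_apply, lineProj_apply, star_mul', star_inv₀,
      star_dotProduct_self_ofReal, star_mul', star_star, mul_comm (star (v b))]

theorem isStarProjection_sub_lineProj {n : Type*} [Fintype n] {P : Matrix n n ℂ}
    (hP : IsStarProjection P) {v : n → ℂ} (h : P *ᵥ v = v) : IsStarProjection (P - lineProj v) :=
  IsStarProjection.sub_of_mul_eq_right (isStarProjection_lineProj v) hP (mul_lineProj h)

theorem lineProj_mul_lineProj {n : Type*} [Fintype n] {v w : n → ℂ} (h : star v ⬝ᵥ w = 0) :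
    lineProj v * lineProj w = 0 := by
  rw [lineProj, lineProj, Matrix.smul_mul, Matrix.mul_smul, Matrix.vecMulVec_mul_vecMulVec, h]
  simp

/-- The cone of operators that are finite sums of projections onto lines. -/
def lineSums (n : Type*) [Fintype n] : AddSubmonoid (Matrix n n ℂ) :=
  AddSubmonoid.closure (Set.range lineProj)

/-- By the spectral theorem: the eigenvalues of a projection are 0 or 1, so it is the sum of the
projections onto its eigenlines of eigenvalue 1. -/
theorem mem_lineSums_of_isStarProjection {n : Type*} [Fintype n] [DecidableEq n] {P : Matrix n n ℂ}
    (hP : IsStarProjection P) : P ∈ lineSums n := by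
  have hH : P.IsHermitian := hP.isSelfAdjoint
  set b := hH.eigenvectorBasis
  have hb (a : n) : star (b a).ofLp ⬝ᵥ (b a).ofLp = 1 := by
    have := b.orthonormal.1 a
    have h2 : inner ℂ (b a) (b a) = 1 := by
      rw [inner_self_eq_norm_sq_to_K, this]; simp
    rwa [EuclideanSpace.inner_eq_star_dotProduct, dotProduct_comm] at h2
  have hone : (1 : Matrix n n ℂ) = ∑ a, lineProj (b a).ofLp := by
    have := Unitary.mul_star_self_of_mem hH.eigenvectorUnitary.2
    rw [← this]
    ext i j
    simp only [Matrix.mul_apply, Matrix.sum_apply, lineProj_apply, hb, Matrix.star_apply,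
      Matrix.IsHermitian.eigenvectorUnitary_apply]
    simp [b]
  have hP' : P = ∑ a, (hH.eigenvalues a : ℂ) • lineProj (b a).ofLp := by
    conv_lhs => rw [← mul_one P, hone, Finset.mul_sum]
    refine Finset.sum_congr rfl fun a _ => ?_
    rw [lineProj, Matrix.mul_smul, Matrix.mul_vecMulVec, hH.mulVec_eigenvectorBasis, smul_comm]
    congr 1
    ext i j
    simp only [Matrix.vecMulVec_apply, Pi.smul_apply, Complex.real_smul, Matrix.smul_apply,
      smul_eq_mul, mul_assoc]
    rfl
  rw [hP']
  refine AddSubmonoid.sum_mem _ fun a _ => ?_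
  have h1 : P *ᵥ (b a).ofLp = hH.eigenvalues a • (b a).ofLp := hH.mulVec_eigenvectorBasis a
  have h2 : P *ᵥ (P *ᵥ (b a).ofLp) = P *ᵥ (b a).ofLp := by
    rw [Matrix.mulVec_mulVec, hP.isIdempotentElem.eq]
  have h3 : hH.eigenvalues a = 0 ∨ hH.eigenvalues a = 1 := by
    rw [h1, Matrix.mulVec_smul, h1] at h2
    have h4 := congrArg (fun x => star (b a).ofLp ⬝ᵥ x) h2
    simp only [dotProduct_smul, hb] at h4
    have h5 : hH.eigenvalues a * hH.eigenvalues a = hH.eigenvalues a := by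
      have h6 : ((hH.eigenvalues a * hH.eigenvalues a : ℝ) : ℂ) = (hH.eigenvalues a : ℝ) := by
        simpa using h4
      exact_mod_cast h6
    rcases eq_or_ne (hH.eigenvalues a) 0 with h | h
    · exact Or.inl h
    · exact Or.inr (by simpa [h] using h5)
  rcases h3 with h | h
  · simp [h, zero_mem]
  · rw [h, Complex.ofReal_one, one_smul]
    exact AddSubmonoid.subset_closure ⟨_, rfl⟩

/-! ### Tensor products of local operators. -/

section Tensor

variable {ι : Type} [Fintype ι] {κ κ' κ'' : ι → Type}

/-- The tensor product of local operators, as a multilinear map. -/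
def tensorOp : MultilinearMap ℂ (fun i => Matrix (κ' i) (κ i) ℂ)
    (Matrix (∀ i, κ' i) (∀ i, κ i) ℂ) where
  toFun A := Matrix.of fun x y => ∏ i, A i (x i) (y i)
  map_update_add' {_} A i X Y := by
    classical
    ext x y
    simp only [Matrix.of_apply, Matrix.add_apply]
    rw [← Finset.mul_prod_erase _ _ (Finset.mem_univ i),
      ← Finset.mul_prod_erase _ _ (Finset.mem_univ i),
      ← Finset.mul_prod_erase _ _ (Finset.mem_univ i)]
    have e (Z : Matrix (κ' i) (κ i) ℂ) :
        ∏ j ∈ Finset.univ.erase i, (Function.update A i Z) j (x j) (y j)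
        = ∏ j ∈ Finset.univ.erase i, A j (x j) (y j) := by
      refine Finset.prod_congr rfl fun j hj => ?_
      rw [Function.update_of_ne (Finset.ne_of_mem_erase hj)]
    simp only [e, Function.update_self, Matrix.add_apply, add_mul]
  map_update_smul' {_} A i c X := by
    classical
    ext x y
    simp only [Matrix.of_apply, Matrix.smul_apply]
    rw [← Finset.mul_prod_erase _ _ (Finset.mem_univ i),
      ← Finset.mul_prod_erase _ _ (Finset.mem_univ i)]
    have e (Z : Matrix (κ' i) (κ i) ℂ) :
        ∏ j ∈ Finset.univ.erase i, (Function.update A i Z) j (x j) (y j)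
        = ∏ j ∈ Finset.univ.erase i, A j (x j) (y j) :=
      Finset.prod_congr rfl fun j hj => by
        rw [Function.update_of_ne (Finset.ne_of_mem_erase hj)]
    simp only [e, Function.update_self, Matrix.smul_apply, smul_eq_mul, mul_assoc]

theorem tensorOp_apply (A : ∀ i, Matrix (κ' i) (κ i) ℂ) (x : ∀ i, κ' i) (y : ∀ i, κ i) :
    tensorOp A x y = ∏ i, A i (x i) (y i) := rfl

theorem tensorOp_mul [DecidableEq ι] [∀ i, Fintype (κ' i)] (A : ∀ i, Matrix (κ'' i) (κ' i) ℂ)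
    (B : ∀ i, Matrix (κ' i) (κ i) ℂ) :
    tensorOp A * tensorOp B = tensorOp fun i => A i * B i := by
  ext x y
  simp only [Matrix.mul_apply, tensorOp_apply, ← Finset.prod_mul_distrib]
  rw [Fintype.prod_sum]

theorem tensorOp_one [∀ i, DecidableEq (κ i)] :
    tensorOp (fun i => (1 : Matrix (κ i) (κ i) ℂ)) = 1 := by
  classical
  ext x y
  simp only [tensorOp_apply, Matrix.one_apply, Finset.prod_ite_zero, Finset.prod_const_one,
    funext_iff, Finset.mem_univ, true_imp_iff]

theorem tensor_ofLp [∀ i, Fintype (κ i)] (φ : ∀ i, κ i → ℂ) (x : ∀ i, κ i) :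
    (tensor fun i => WithLp.toLp 2 (φ i)).ofLp x = ∏ i, φ i (x i) := rfl

theorem tensorOp_mulVec_tensor [DecidableEq ι] [∀ i, Fintype (κ i)] [∀ i, Fintype (κ' i)]
    (A : ∀ i, Matrix (κ' i) (κ i) ℂ) (φ : ∀ i, κ i → ℂ) :
    tensorOp A *ᵥ (tensor fun i => WithLp.toLp 2 (φ i)).ofLp
      = (tensor fun i => WithLp.toLp 2 (A i *ᵥ φ i)).ofLp := by
  ext x
  simp only [Matrix.mulVec, dotProduct, tensorOp_apply, tensor_ofLp, ← Finset.prod_mul_distrib]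
  rw [Fintype.prod_sum]

theorem star_tensor_dotProduct_tensor [DecidableEq ι] [∀ i, Fintype (κ i)] (φ χ : ∀ i, κ i → ℂ) :
    star (tensor fun i => WithLp.toLp 2 (φ i)).ofLp ⬝ᵥ (tensor fun i => WithLp.toLp 2 (χ i)).ofLp
      = ∏ i, (star (φ i) ⬝ᵥ χ i) := by
  simp only [dotProduct, tensor_ofLp, Pi.star_apply, star_prod, ← Finset.prod_mul_distrib]
  rw [Fintype.prod_sum]

/-- Zero factors need no exception, because `0⁻¹ = 0` makes both sides vanish. -/
theorem lineProj_tensor [DecidableEq ι] [∀ i, Fintype (κ i)] (φ : ∀ i, κ i → ℂ) :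
    lineProj (tensor fun i => WithLp.toLp 2 (φ i)).ofLp = tensorOp fun i => lineProj (φ i) := by
  ext x y
  simp only [lineProj_apply, star_tensor_dotProduct_tensor, tensorOp_apply, tensor_ofLp,
    Finset.prod_mul_distrib, star_prod, Finset.prod_inv_distrib]

theorem applyLocal_eq [DecidableEq ι] [∀ i, Fintype (κ i)] [∀ i, DecidableEq (κ i)] (i : ι)
    (A : Matrix (κ i) (κ i) ℂ) (ψ : Joint κ) :
    applyLocal i A ψ = WithLp.toLp 2 (tensorOp (Function.update 1 i A) *ᵥ ψ.ofLp) := by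
  have key (x y : ∀ i, κ i) : tensorOp (Function.update 1 i A) x y
      = ∑ z : κ i, if Function.update x i z = y then A (x i) z else 0 := by
    rw [tensorOp_apply, ← Finset.mul_prod_erase _ _ (Finset.mem_univ i), Function.update_self]
    have : ∏ j ∈ Finset.univ.erase i,
        (Function.update (1 : ∀ i, Matrix (κ i) (κ i) ℂ) i A) j (x j) (y j)
        = ∏ j ∈ Finset.univ.erase i, if x j = y j then 1 else 0 :=
      Finset.prod_congr rfl fun j hj => by
        rw [Function.update_of_ne (Finset.ne_of_mem_erase hj), Pi.one_apply, Matrix.one_apply]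
    rw [this, Finset.prod_ite_zero, Finset.prod_const_one]
    have h2 (z : κ i) : Function.update x i z = y ↔
        z = y i ∧ ∀ j ∈ Finset.univ.erase i, x j = y j := by
      rw [Function.update_eq_iff]
      simp
    simp only [h2, ite_and, Finset.sum_ite_eq', Finset.mem_univ, if_true, mul_ite, mul_one, mul_zero]
  ext x
  simp only [applyLocal, Matrix.mulVec, dotProduct, key, Finset.sum_mul, ite_mul, zero_mul]
  rw [Finset.sum_comm]
  simp

theorem applyLocal_tensor [DecidableEq ι] [∀ i, Fintype (κ i)] (i : ι)
    (A : Matrix (κ i) (κ i) ℂ) (φ : ∀ i, κ i → ℂ) :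
    applyLocal i A (tensor fun i => WithLp.toLp 2 (φ i))
      = tensor fun j => WithLp.toLp 2 (Function.update φ i (A *ᵥ φ i) j) := by
  classical
  rw [applyLocal_eq, tensorOp_mulVec_tensor]
  congr 1; ext x
  simp only [tensor_ofLp]
  refine Finset.prod_congr rfl fun j _ => ?_
  by_cases h : j = i
  · subst h; simp
  · simp [h]

/-- The cone of operators that are finite sums of projections onto lines of product vectors. -/
def productLineSums (κ : ι → Type) [∀ i, Fintype (κ i)] :
    AddSubmonoid (Matrix (∀ i, κ i) (∀ i, κ i) ℂ) :=
  AddSubmonoid.closure (Set.range fun v : ∀ i, κ i → ℂ => tensorOp fun i => lineProj (v i))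

theorem tensorOp_mem_productLineSums [∀ i, Fintype (κ i)] {A : ∀ i, Matrix (κ i) (κ i) ℂ}
    (hA : ∀ i, A i ∈ lineSums (κ i)) : tensorOp A ∈ productLineSums κ := by
  classical
  -- `s` contains the slots still to be expanded; outside `s` each factor is already a single line.
  -- Multilinearity expands one slot at a time.
  suffices h : ∀ (s : Finset ι) (A : ∀ i, Matrix (κ i) (κ i) ℂ), (∀ i, A i ∈ lineSums (κ i)) →
      (∀ i ∉ s, A i ∈ Set.range lineProj) → tensorOp A ∈ productLineSums κ from
    h Finset.univ A hA (by simp)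
  intro s
  induction s using Finset.induction with
  | empty =>
    intro A _ hA
    choose v hv using fun i => hA i (Finset.notMem_empty i)
    exact AddSubmonoid.subset_closure ⟨v, by simp only [hv]⟩
  | insert i s _ ih =>
    intro A hA hs
    rw [← Function.update_eq_self i A]
    refine AddSubmonoid.closure_induction
      (motive := fun X _ => tensorOp (Function.update A i X) ∈ productLineSums κ)
      ?_ ?_ ?_ (hA i)
    · intro X hX
      refine ih _ (fun j => ?_) fun j hj => ?_
      · by_cases h : j = i
        · subst h; simpa [lineSums] using AddSubmonoid.subset_closure hX
        · simpa [h] using hA j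
      · by_cases h : j = i
        · subst h; simpa using hX
        · simpa [h] using hs j (by simp [h, hj])
    · rw [MultilinearMap.map_update_zero]; exact zero_mem _
    · intro X Y _ _ hX hY
      rw [MultilinearMap.map_update_add]
      exact add_mem hX hY

end Tensor

/-! ### Von Neumann protocols: the induction on the tree. -/

section

variable {ι : Type} [Fintype ι] [DecidableEq ι] {κ : ι → Type} [∀ i, Fintype (κ i)]

/-- At most one member of the family `ψ` gives nonzero probability to each record. -/
def Protocol.Separates {I : Type*} (T : Protocol κ) (ψ : I → Joint κ) : Prop :=
  ∀ b s t, T.run b (ψ s) ≠ 0 → T.run b (ψ t) ≠ 0 → s = t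

theorem Protocol.Distinguishes.separates {T : Protocol κ} {S : Set (Joint κ)}
    (h : T.Distinguishes S) : T.Separates (fun ψ : S => (ψ : Joint κ)) := by
  obtain ⟨g, hg⟩ := h
  intro b s t hs ht
  have := hg s s.2 b (by simpa [Protocol.prob] using hs)
  have := hg t t.2 b (by simpa [Protocol.prob] using ht)
  exact Subtype.ext (by simp_all)

theorem isStarProjection_sum_lineProj {n α : Type*} [Fintype n] [Fintype α]
    {v : α → n → ℂ} (h : ∀ a b, a ≠ b → star (v a) ⬝ᵥ v b = 0) :
    IsStarProjection (∑ a, lineProj (v a)) where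
  isIdempotentElem := by
    classical
    rw [IsIdempotentElem, Finset.sum_mul_sum]
    refine Finset.sum_congr rfl fun a _ => ?_
    rw [Finset.sum_eq_single a]
    · exact (isStarProjection_lineProj _).isIdempotentElem
    · exact fun b _ hb => lineProj_mul_lineProj (h a b hb.symm)
    · simp
  isSelfAdjoint := isSelfAdjoint_sum _ fun a _ => (isStarProjection_lineProj _).isSelfAdjoint

/-- Splitting `v` by mutually orthogonal projections refines the line through `v` into orthogonal
lines that still span `v`. -/
theorem sum_lineProj_sub_mem_lineSums {n α : Type*} [Fintype n] [Fintype α]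
    {M : α → Matrix n n ℂ} (hM : ∀ k, IsStarProjection (M k)) (hMM : ∀ k l, k ≠ l → M k * M l = 0)
    {v : n → ℂ} (hv : (∑ k, M k) *ᵥ v = v) :
    ∑ k, lineProj (M k *ᵥ v) - lineProj v ∈ lineSums n := by
  classical
  refine mem_lineSums_of_isStarProjection (isStarProjection_sub_lineProj
    (isStarProjection_sum_lineProj fun k l hkl => ?_) ?_)
  · have hk : (M k)ᴴ = M k := (hM k).isSelfAdjoint
    rw [Matrix.star_mulVec, hk, ← Matrix.dotProduct_mulVec, Matrix.mulVec_mulVec, hMM k l hkl]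
    simp
  · rw [Matrix.sum_mulVec]
    conv_rhs => rw [← hv, Matrix.sum_mulVec]
    refine Finset.sum_congr rfl fun k _ => ?_
    have hk : (M k)ᴴ = M k := (hM k).isSelfAdjoint
    -- Since `M k` is a projection, `v` and `M k *ᵥ v` have the same inner product with `M k *ᵥ v`.
    -- Hence the line projection sends `v` to `M k *ᵥ v`, and these parts add up to `v`.
    have h1 : star (M k *ᵥ v) ⬝ᵥ v = star (M k *ᵥ v) ⬝ᵥ (M k *ᵥ v) := by
      conv_rhs => rw [Matrix.star_mulVec, hk, ← Matrix.dotProduct_mulVec, Matrix.mulVec_mulVec,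
        (hM k).isIdempotentElem.eq]
      rw [Matrix.star_mulVec, hk, ← Matrix.dotProduct_mulVec]
    have h2 := lineProj_mulVec_self (M k *ᵥ v)
    rw [lineProj, Matrix.smul_mulVec, Matrix.vecMulVec_mulVec] at h2 ⊢
    rw [h1]; exact h2

theorem tensorOp_lineProj_eq_zero {φ : ∀ i, κ i → ℂ} (h : (tensor fun i => WithLp.toLp 2 (φ i)) = 0) :
    tensorOp (fun i => lineProj (φ i)) = 0 := by
  rw [← lineProj_tensor, h]
  exact lineProj_zero

/-- A product vector in a product subspace extends to an orthogonal product basis of it. -/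
theorem tensorOp_sub_lineProj_mem {P : ∀ i, Matrix (κ i) (κ i) ℂ}
    (hP : ∀ i, IsStarProjection (P i)) {φ : ∀ i, κ i → ℂ} (hφ : ∀ i, P i *ᵥ φ i = φ i) :
    tensorOp P - tensorOp (fun i => lineProj (φ i)) ∈ productLineSums κ := by
  classical
  -- Split every slot into the line and its complement and expand. The term with the line in every
  -- slot cancels; each remaining term is a tensor product of projections.
  have e : P = (fun i => lineProj (φ i)) + fun i => P i - lineProj (φ i) := by
    ext1 i; simp
  rw [congrArg tensorOp e, MultilinearMap.map_add_univ,
    ← Finset.add_sum_erase _ _ (Finset.mem_univ Finset.univ),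
    Finset.piecewise_univ, add_sub_cancel_left]
  refine AddSubmonoid.sum_mem _ fun s _ => tensorOp_mem_productLineSums fun i => ?_
  by_cases h : i ∈ s
  · rw [Finset.piecewise_eq_of_mem _ _ _ h]
    exact AddSubmonoid.subset_closure ⟨_, rfl⟩
  · rw [Finset.piecewise_eq_of_notMem _ _ _ h]
    exact mem_lineSums_of_isStarProjection (isStarProjection_sub_lineProj (hP i) (hφ i))

/-- The vectors are neither normalized nor assumed orthogonal: the index set stays fixed along the
tree, and a vector annihilated by an outcome contributes a zero term. -/
theorem Protocol.IsVonNeumann.sub_sum_mem [∀ i, DecidableEq (κ i)] {I : Type*} [Fintype I]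
    {T : Protocol κ} {P : ∀ i, Matrix (κ i) (κ i) ℂ} (hT : T.IsVonNeumann P)
    (hP : ∀ i, IsStarProjection (P i)) {φ : I → ∀ i, κ i → ℂ} (hφ : ∀ s i, P i *ᵥ φ s i = φ s i)
    (hS : T.Separates fun s => tensor fun i => WithLp.toLp 2 (φ s i)) :
    tensorOp P - ∑ s, tensorOp (fun i => lineProj (φ s i)) ∈ productLineSums κ := by
  classical
  induction T generalizing P φ with
  | done =>
    by_cases h : ∃ s, (tensor fun i => WithLp.toLp 2 (φ s i)) ≠ 0
    · obtain ⟨s, hs⟩ := h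
      rw [Finset.sum_eq_single s]
      · exact tensorOp_sub_lineProj_mem hP (hφ s)
      · intro t _ hts
        refine tensorOp_lineProj_eq_zero ?_
        by_contra ht
        exact hts (hS () t s ht hs)
      · simp
    · push Not at h
      rw [Finset.sum_eq_zero fun s _ => tensorOp_lineProj_eq_zero (h s), sub_zero]
      exact tensorOp_mem_productLineSums fun i => mem_lineSums_of_isStarProjection (hP i)
  | measure i n M next ih =>
    obtain ⟨hM, hMM, hsum, hnext⟩ := hT
    have hM' (k) : IsStarProjection (M k) := ⟨(hM k).2, (hM k).1⟩
    have hk (k : Fin n) : tensorOp (Function.update P i (M k)) - ∑ s,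
        tensorOp (fun j => lineProj (Function.update (φ s) i (M k *ᵥ φ s i) j))
          ∈ productLineSums κ := by
      refine ih k (hnext k) (fun j => ?_) (fun s j => ?_) ?_
      · by_cases h : j = i
        · subst h; simpa using hM' k
        · simpa [h] using hP j
      · by_cases h : j = i
        · subst h; simp [(hM k).2]
        · simpa [h] using hφ s j
      · intro b s t hs ht
        refine hS ⟨k, b⟩ s t ?_ ?_
        · simpa only [Protocol.run, applyLocal_tensor] using hs
        · simpa only [Protocol.run, applyLocal_tensor] using ht
    have hupd (s : I) (k : Fin n) :
        (fun j => lineProj (Function.update (φ s) i (M k *ᵥ φ s i) j))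
          = Function.update (fun j => lineProj (φ s j)) i (lineProj (M k *ᵥ φ s i)) := by
      ext1 j
      by_cases h : j = i
      · subst h; simp
      · simp [h]
    -- Cost of recombining the parts of vector `s`: only slot `i` differs between branches, so the
    -- difference is taken inside that slot.
    have hs (s : I) : tensorOp (Function.update (fun j => lineProj (φ s j)) i
        (∑ k, lineProj (M k *ᵥ φ s i) - lineProj (φ s i))) ∈ productLineSums κ := by
      refine tensorOp_mem_productLineSums fun j => ?_
      by_cases h : j = i
      · subst h
        rw [Function.update_self]
        exact sum_lineProj_sub_mem_lineSums hM' hMM (by rw [hsum]; exact hφ s j)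
      · rw [Function.update_of_ne h]
        exact AddSubmonoid.subset_closure ⟨_, rfl⟩
    have hPsum : tensorOp P = ∑ k, tensorOp (Function.update P i (M k)) := by
      rw [← MultilinearMap.map_update_sum, hsum, Function.update_eq_self]
    have := add_mem (AddSubmonoid.sum_mem _ fun k (_ : k ∈ Finset.univ) => hk k)
      (AddSubmonoid.sum_mem _ fun s (_ : s ∈ Finset.univ) => hs s)
    -- The sums over `k` and `s` of the lines of the parts cancel between the two contributions.
    convert this using 1
    simp only [hupd, MultilinearMap.map_update_sub, MultilinearMap.map_update_sum,
      Finset.sum_sub_distrib, hPsum, Function.update_eq_self]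
    rw [Finset.sum_comm]
    abel

/-! ### From a resolution of the identity to an orthonormal product basis. -/

open scoped ComplexOrder in
theorem exists_productState_lineProj_eq (v : ∀ i, κ i → ℂ) :
    tensorOp (fun i => lineProj (v i)) = 0 ∨ ∃ c : Joint κ, IsProductState c ∧
      tensorOp (fun i => lineProj (v i)) = lineProj c.ofLp := by
  by_cases h : ∃ i, v i = 0
  · left
    obtain ⟨i, hi⟩ := h
    exact MultilinearMap.map_coord_zero _ i (by simp [hi, lineProj_zero])
  · push Not at h
    right
    have hne (i) : ‖WithLp.toLp 2 (v i)‖ ≠ 0 := by simpa using h i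
    refine ⟨tensor fun i => WithLp.toLp 2 (((‖WithLp.toLp 2 (v i)‖⁻¹ : ℝ) : ℂ) • v i),
      ⟨_, fun i => ?_, rfl⟩, ?_⟩
    · rw [WithLp.toLp_smul, norm_smul]
      simp [hne]
    · rw [lineProj_tensor]
      congr 1; ext1 i
      rw [lineProj_smul]
      exact_mod_cast inv_ne_zero (hne i)

theorem exists_productStates_of_mem {A : Matrix (∀ i, κ i) (∀ i, κ i) ℂ}
    (hA : A ∈ productLineSums κ) : ∃ (n : ℕ) (c : Fin n → Joint κ), (∀ j, IsProductState (c j)) ∧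
      A = ∑ j, lineProj (c j).ofLp := by
  induction hA using AddSubmonoid.closure_induction with
  | mem X hX =>
    obtain ⟨v, rfl⟩ := hX
    rcases exists_productState_lineProj_eq v with h | ⟨c, hc, h⟩
    · exact ⟨0, Fin.elim0, fun j => j.elim0, by simpa using h⟩
    · exact ⟨1, fun _ => c, fun _ => hc, by simpa using h⟩
  | zero => exact ⟨0, Fin.elim0, fun j => j.elim0, by simp⟩
  | add X Y _ _ hX hY =>
    obtain ⟨n, c, hc, rfl⟩ := hX
    obtain ⟨m, c', hc', rfl⟩ := hY
    refine ⟨n + m, Fin.append c c', fun j => ?_, by simp [Fin.sum_univ_add]⟩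
    induction j using Fin.addCases <;> simp [hc, hc']

theorem IsProductState.norm_eq_one {ψ : Joint κ} (h : IsProductState ψ) : ‖ψ‖ = 1 := by
  obtain ⟨φ, hφ, rfl⟩ := h
  have key (n : Type) [Fintype n] (x : EuclideanSpace ℂ n) :
      star x.ofLp ⬝ᵥ x.ofLp = ((‖x‖ ^ 2 : ℝ) : ℂ) := by
    rw [dotProduct_comm, ← EuclideanSpace.inner_eq_star_dotProduct, inner_self_eq_norm_sq_to_K]
    simp
  have h1 := star_tensor_dotProduct_tensor (fun i => (φ i).ofLp) (fun i => (φ i).ofLp)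
  simp only [key, hφ] at h1
  have h3 : ((‖tensor φ‖ ^ 2 : ℝ) : ℂ) = 1 := by
    simpa only [one_pow, Complex.ofReal_one, Finset.prod_const_one] using h1
  have h4 : ‖tensor φ‖ ^ 2 = 1 := by exact_mod_cast h3
  exact (pow_eq_one_iff_of_nonneg (norm_nonneg _) two_ne_zero).1 h4

theorem lineProj_mulVec_eq_inner_smul {n : Type*} [Fintype n] {c : EuclideanSpace ℂ n}
    (hc : ‖c‖ = 1) (x : EuclideanSpace ℂ n) :
    WithLp.toLp 2 (lineProj c.ofLp *ᵥ x.ofLp) = inner ℂ c x • c := by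
  have h1 : star c.ofLp ⬝ᵥ c.ofLp = 1 := by
    rw [dotProduct_comm, ← EuclideanSpace.inner_eq_star_dotProduct, inner_self_eq_norm_sq_to_K, hc]
    simp
  ext a
  rw [lineProj, Matrix.smul_mulVec, Matrix.vecMulVec_mulVec, h1,
    EuclideanSpace.inner_eq_star_dotProduct, dotProduct_comm]
  simp [mul_comm]

/-- Unit vectors that resolve the identity form an orthonormal basis. -/
theorem span_eq_top_and_inner_eq_zero {n J : Type*} [Fintype n] [DecidableEq n] [Fintype J]
    {v : J → EuclideanSpace ℂ n} (hv : ∀ j, ‖v j‖ = 1) (h : ∑ j, lineProj (v j).ofLp = 1) :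
    Submodule.span ℂ (Set.range v) = ⊤ ∧ ∀ j l, j ≠ l → inner ℂ (v j) (v l) = 0 := by
  classical
  have hx (x : EuclideanSpace ℂ n) : ∑ j, inner ℂ (v j) x • v j = x := by
    simp only [← lineProj_mulVec_eq_inner_smul (hv _), ← WithLp.toLp_sum, ← Matrix.sum_mulVec, h,
      Matrix.one_mulVec]
  refine ⟨?_, fun j l hjl => ?_⟩
  · rw [eq_top_iff]
    intro x _
    rw [← hx x]
    exact Submodule.sum_mem _ fun j _ => Submodule.smul_mem _ _ (Submodule.subset_span ⟨j, rfl⟩)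
  -- Parseval for the unit vector `v l`: the term `j = l` already equals 1, so all the others
  -- vanish.
  · have h1 : ∑ j, ‖inner ℂ (v j) (v l)‖ ^ 2 = 1 := by
      have h2 : inner ℂ (v l) (∑ j, inner ℂ (v j) (v l) • v j) = inner ℂ (v l) (v l) := by
        rw [hx]
      rw [inner_sum, inner_self_eq_norm_sq_to_K, hv] at h2
      have h3 : ((∑ j, ‖inner ℂ (v j) (v l)‖ ^ 2 : ℝ) : ℂ) = 1 := by
        rw [Complex.ofReal_sum]
        refine (Finset.sum_congr rfl fun j _ => ?_).trans (h2.trans (by simp))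
        rw [inner_smul_right, ← inner_conj_symm (v l) (v j), Complex.mul_conj,
          Complex.normSq_eq_norm_sq]
      exact_mod_cast h3
    have h2 : ‖inner ℂ (v l) (v l)‖ ^ 2 = 1 := by
      rw [inner_self_eq_norm_sq_to_K, hv]; simp
    have h3 := Finset.sum_erase_eq_sub (f := fun j => ‖inner ℂ (v j) (v l)‖ ^ 2)
      (Finset.mem_univ l)
    rw [h1, h2, sub_self, Finset.sum_eq_zero_iff_of_nonneg fun _ _ => by positivity] at h3
    simpa using h3 j (by simpa using hjl)

theorem MeasurableByVonNeumann.isCompletable [∀ i, DecidableEq (κ i)] {S : Set (Joint κ)}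
    (hS : IsOrthogonalProductSet S) (hT : MeasurableByVonNeumann S) : IsCompletable S := by
  classical
  obtain ⟨T, hVN, hd⟩ := hT
  -- Orthogonality of `S` serves here only to make `S` finite.
  have horth : Orthonormal ℂ (fun ψ : S => (ψ : Joint κ)) :=
    ⟨fun ψ => (hS.1 ψ ψ.2).norm_eq_one, fun ψ χ h =>
      hS.2 ψ.2 χ.2 fun e => h (Subtype.ext e)⟩
  have : Finite S := horth.linearIndependent.finite
  have := Fintype.ofFinite S
  choose φ hφ hφS using fun ψ : S => hS.1 ψ ψ.2
  have hmem := hVN.sub_sum_mem (fun _ => .one _) (φ := fun s i => (φ s i).ofLp) (by simp)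
    (by simpa only [WithLp.toLp_ofLp, ← hφS] using hd.separates)
  simp only [tensorOp_one] at hmem
  obtain ⟨n, c, hc, hsum⟩ := exists_productStates_of_mem hmem
  have hv : ∀ j : S ⊕ Fin n, IsProductState (Sum.elim (fun ψ : S => (ψ : Joint κ)) c j) := by
    rintro (ψ | j)
    · exact hS.1 ψ ψ.2
    · exact hc j
  obtain ⟨h1, h2⟩ := span_eq_top_and_inner_eq_zero (v := Sum.elim (fun ψ : S => (ψ : Joint κ)) c)
    (fun j => (hv j).norm_eq_one) (by
      rw [Fintype.sum_sum_type]
      simp only [Sum.elim_inl, Sum.elim_inr, ← hsum]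
      simp only [← lineProj_tensor, WithLp.toLp_ofLp, ← hφS]
      abel)
  refine ⟨Set.range (Sum.elim (fun ψ : S => (ψ : Joint κ)) c),
    fun ψ hψ => ⟨Sum.inl ⟨ψ, hψ⟩, rfl⟩, ⟨?_, ?_⟩, h1⟩
  · rintro _ ⟨j, rfl⟩
    exact hv j
  · rintro _ ⟨j, rfl⟩ _ ⟨l, rfl⟩ hjl
    exact h2 j l fun e => hjl (by rw [e])

end

/-! ### Naimark dilation. -/

section

section Dilation

variable {n k : Type} [Fintype n] [Fintype k] [DecidableEq k]

/-- `P` is a projection with range containing that of the isometry `U`, and the orthogonal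
complement of the range of `U` in that of `P` has dimension at least `N`. -/
def IsFrame (N : ℕ) (P : Matrix n n ℂ) (U : Matrix n k ℂ) : Prop :=
  ∃ r, N ≤ r ∧ ∃ W : Matrix n (k ⊕ Fin r) ℂ,
    Wᴴ * W = 1 ∧ P = W * Wᴴ ∧ U = W.submatrix id Sum.inl

theorem IsFrame.mono {N N' : ℕ} (h : N ≤ N') {P : Matrix n n ℂ} {U : Matrix n k ℂ}
    (hf : IsFrame N' P U) : IsFrame N P U := by
  obtain ⟨r, hr, h'⟩ := hf
  exact ⟨r, h.trans hr, h'⟩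

/-- An isometry extends to a unitary. -/
theorem exists_unitary_extension {E l : Type} [Fintype E] [DecidableEq E] [Fintype l]
    [DecidableEq l] (hc : Fintype.card E = Fintype.card (k ⊕ l)) {V : Matrix E k ℂ}
    (hV : Vᴴ * V = 1) :
    ∃ G : Matrix E (k ⊕ l) ℂ, Gᴴ * G = 1 ∧ G * Gᴴ = 1 ∧ G.submatrix id Sum.inl = V := by
  -- The zeros on `l` are placeholders: only the values on `k` are prescribed to the basis
  -- extension.
  let v : k ⊕ l → EuclideanSpace ℂ E := Sum.elim (fun a => WithLp.toLp 2 fun e => V e a) 0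
  have hinner {m : Type} [DecidableEq m] (G : Matrix E m ℂ) (a b : m) :
      inner ℂ (WithLp.toLp 2 fun e => G e a : EuclideanSpace ℂ E) (WithLp.toLp 2 fun e => G e b)
        = (Gᴴ * G) a b := by
    rw [EuclideanSpace.inner_eq_star_dotProduct, dotProduct_comm]
    rfl
  have hv : Orthonormal ℂ ((Set.range (Sum.inl : k → k ⊕ l)).domRestrict v) := by
    rw [orthonormal_iff_ite]
    rintro ⟨_, a, rfl⟩ ⟨_, b, rfl⟩
    have : inner ℂ (v (Sum.inl a)) (v (Sum.inl b)) = (1 : Matrix k k ℂ) a b := by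
      rw [← hV]; exact hinner V a b
    refine this.trans ?_
    rw [Matrix.one_apply]
    exact if_congr ⟨fun h => Subtype.ext (congrArg Sum.inl h),
      fun h => Sum.inl_injective (congrArg Subtype.val h)⟩ rfl rfl
  obtain ⟨b, hb⟩ := hv.exists_orthonormalBasis_extension_of_card_eq (by simpa using hc)
  let G : Matrix E (k ⊕ l) ℂ := Matrix.of fun e a => b a e
  have hG : Gᴴ * G = 1 := by
    ext a c
    rw [← hinner, Matrix.one_apply]
    exact orthonormal_iff_ite.1 b.orthonormal a c
  refine ⟨G, hG, (Matrix.mul_eq_one_comm_of_card_eq _ _ _ hc.symm).1 hG, ?_⟩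
  ext e a
  change (b (Sum.inl a)).ofLp e = V e a
  rw [hb _ ⟨a, rfl⟩]
  rfl

/-- **Naimark dilation** of a POVM inside a projection of sufficiently large rank. -/
theorem IsFrame.exists_dilation {m : ℕ} (hm : 0 < m) {M : Fin m → Matrix k k ℂ}
    (hM : ∑ l, (M l)ᴴ * M l = 1) {N : Fin m → ℕ} {P : Matrix n n ℂ} {U : Matrix n k ℂ}
    (h : IsFrame (m * Fintype.card k + ∑ l, N l) P U) :
    ∃ (Q : Fin m → Matrix n n ℂ) (U' : Fin m → Matrix n k ℂ),
      (∀ l, (Q l).IsHermitian ∧ Q l * Q l = Q l) ∧ (∀ l l', l ≠ l' → Q l * Q l' = 0) ∧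
      ∑ l, Q l = P ∧ ∀ l, IsFrame (N l) (Q l) (U' l) ∧ Q l * U = U' l * M l := by
  obtain ⟨r, hr, W, hW, rfl, rfl⟩ := h
  -- Outcome 0 absorbs the surplus dimension, so that the blocks `k ⊕ Fin (R l)` together have
  -- exactly the size of `k ⊕ Fin r`; the subtraction does not truncate because of `hr`.
  let R : Fin m → ℕ := fun l => N l +
    if l = ⟨0, hm⟩ then Fintype.card k + r - (m * Fintype.card k + ∑ l, N l) else 0
  let E := Σ l : Fin m, k ⊕ Fin (R l)
  have hc : Fintype.card E = Fintype.card (k ⊕ Fin r) := by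
    simp only [E, R, Fintype.card_sigma, Fintype.card_sum, Fintype.card_fin,
      Finset.sum_add_distrib, Finset.sum_ite_eq', Finset.mem_univ, if_true, Finset.sum_const,
      Finset.card_univ, smul_eq_mul]
    omega
  -- The operators `M l` stacked as blocks and padded by zeros; the POVM condition says precisely
  -- that `V` is an isometry.
  let V : Matrix E k ℂ := Matrix.of fun e b => Sum.elim (fun a => M e.1 a b) (fun _ => 0) e.2
  have hV : Vᴴ * V = 1 := by
    rw [← hM]
    ext a b
    simp [Matrix.mul_apply, Matrix.sum_apply, V, E, Fintype.sum_sigma]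
  obtain ⟨G, hG, hG', hGV⟩ := exists_unitary_extension hc hV
  let g (l : Fin m) : Matrix (k ⊕ Fin (R l)) (k ⊕ Fin r) ℂ := G.submatrix (fun x => (⟨l, x⟩ : E)) id
  have hgg (l) : g l * (g l)ᴴ = 1 := by
    exact (congrArg (fun X => X.submatrix (fun x => (⟨l, x⟩ : E)) (fun x => (⟨l, x⟩ : E))) hG').trans
      (Matrix.submatrix_one _ sigma_mk_injective)
  have hgg' (l l') (hl : l ≠ l') : g l * (g l')ᴴ = 0 := by
    ext a b
    have := congrFun (congrFun hG' ⟨l, a⟩) ⟨l', b⟩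
    rw [Matrix.one_apply_ne (by simp [hl])] at this
    exact this
  have hsum : ∑ l, (g l)ᴴ * g l = 1 := by
    rw [← hG]
    ext a b
    simp [Matrix.mul_apply, Matrix.sum_apply, g, E, Fintype.sum_sigma]
  have hgV (l) (x) (b : k) : g l x (Sum.inl b) = Sum.elim (fun a => M l a b) (fun _ => 0) x :=
    congrFun (congrFun hGV ⟨l, x⟩) b
  have hWW {a b : Type} (X : Matrix a (k ⊕ Fin r) ℂ) (Y : Matrix (k ⊕ Fin r) b ℂ) :
      X * Wᴴ * (W * Y) = X * Y := by
    rw [Matrix.mul_assoc, ← Matrix.mul_assoc Wᴴ, hW, Matrix.one_mul]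
  have hQQ (l l') : W * (g l)ᴴ * (W * (g l)ᴴ)ᴴ * (W * (g l')ᴴ * (W * (g l')ᴴ)ᴴ)
      = W * (g l)ᴴ * (g l * (g l')ᴴ) * (W * (g l')ᴴ)ᴴ := by
    simp only [Matrix.conjTranspose_mul, Matrix.conjTranspose_conjTranspose, Matrix.mul_assoc]
    rw [← Matrix.mul_assoc Wᴴ W, hW, Matrix.one_mul]
  -- With `g l` the `l`-th row block of the unitary `G`, the columns of `W * (g l)ᴴ` are an
  -- orthonormal basis of the range of the `l`-th projection. The first columns of `g l` are `M l`
  -- over zeros, which gives `Q l * U = U' l * M l`.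
  refine ⟨fun l => W * (g l)ᴴ * (W * (g l)ᴴ)ᴴ, fun l => (W * (g l)ᴴ).submatrix id Sum.inl,
    fun l => ⟨Matrix.isHermitian_mul_conjTranspose_self _, ?_⟩, fun l l' hl => ?_, ?_, fun l =>
    ⟨⟨R l, Nat.le_add_right _ _, W * (g l)ᴴ, ?_, rfl, rfl⟩, ?_⟩⟩
  · rw [hQQ, hgg, Matrix.mul_one]
  · rw [hQQ, hgg' l l' hl]; simp
  · simp only [Matrix.conjTranspose_mul, Matrix.conjTranspose_conjTranspose, Matrix.mul_assoc]
    rw [← Matrix.mul_sum]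
    simp only [← Matrix.mul_assoc]
    rw [← Matrix.sum_mul, hsum, Matrix.one_mul]
  · rw [Matrix.conjTranspose_mul, Matrix.conjTranspose_conjTranspose, hWW, hgg]
  · have e1 : W * (g l)ᴴ * (W * (g l)ᴴ)ᴴ * W = W * (g l)ᴴ * g l := by
      rw [Matrix.conjTranspose_mul, Matrix.conjTranspose_conjTranspose, Matrix.mul_assoc,
        Matrix.mul_assoc (g l), hW, Matrix.mul_one]
    ext a b
    have e2 := congrFun (congrFun e1 a) (Sum.inl b)
    refine (Eq.trans ?_ e2).trans ?_
    · rfl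
    · rw [Matrix.mul_apply, Fintype.sum_sum_type]
      simp only [hgV]
      simp [Matrix.mul_apply]

end Dilation

/-! ### Simulation of POVM protocols by von Neumann protocols. -/

variable {ι : Type} [Fintype ι] [DecidableEq ι] {κ κ' : ι → Type} [∀ i, Fintype (κ i)]
  [∀ i, Fintype (κ' i)]

/-- The product operator `⨂ i, U i` applied to a joint vector. -/
def tensorApply (U : ∀ i, Matrix (κ' i) (κ i) ℂ) (ψ : Joint κ) : Joint κ' :=
  WithLp.toLp 2 (tensorOp U *ᵥ ψ.ofLp)

/-- One simulated step: the dilated state stays the image of the original post-measurement state,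
under an isometry that now depends on the outcome. -/
theorem applyLocal_tensorApply {U : ∀ i, Matrix (κ' i) (κ i) ℂ} {i : ι}
    {Q : Matrix (κ' i) (κ' i) ℂ} {U' : Matrix (κ' i) (κ i) ℂ} {A : Matrix (κ i) (κ i) ℂ}
    (h : Q * U i = U' * A) (ψ : Joint κ) :
    applyLocal i Q (tensorApply U ψ) = tensorApply (Function.update U i U') (applyLocal i A ψ) := by
  classical
  rw [applyLocal_eq, applyLocal_eq, tensorApply, tensorApply]
  simp only [Matrix.mulVec_mulVec, tensorOp_mul]
  congr 3
  ext1 j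
  by_cases hj : j = i
  · subst hj; simpa using h
  · simp [hj]

/-- A POVM protocol is simulated by a von Neumann protocol on larger local spaces. -/
theorem Protocol.IsPOVM.exists_isVonNeumann [∀ i, DecidableEq (κ i)] {T : Protocol κ}
    (hT : T.IsPOVM) : ∃ N : ι → ℕ, ∀ (κ' : ι → Type) [∀ i, Fintype (κ' i)]
      [∀ i, DecidableEq (κ' i)] (P : ∀ i, Matrix (κ' i) (κ' i) ℂ)
      (U : ∀ i, Matrix (κ' i) (κ i) ℂ), (∀ i, IsFrame (N i) (P i) (U i)) →
      ∃ T' : Protocol κ', T'.IsVonNeumann P ∧ ∀ b' ψ χ, T'.run b' (tensorApply U ψ) ≠ 0 →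
        T'.run b' (tensorApply U χ) ≠ 0 → ∃ b, T.run b ψ ≠ 0 ∧ T.run b χ ≠ 0 := by
  induction T with
  | done =>
    refine ⟨fun _ => 0, fun κ' _ _ P U _ => ⟨.done, trivial, fun _ ψ χ hψ hχ => ⟨(), ?_, ?_⟩⟩⟩
    · rintro rfl
      exact hψ (by simp [Protocol.run, tensorApply])
    · rintro rfl
      exact hχ (by simp [Protocol.run, tensorApply])
  | measure i m M next ih =>
    obtain ⟨hM, hnext⟩ := hT
    rcases Nat.eq_zero_or_pos m with rfl | hm
    -- An empty measurement has `0 = 1` as its completeness relation, so the local space, and with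
    -- it the joint space, is zero.
    · have : IsEmpty (κ i) := by
        refine ⟨fun a => ?_⟩
        simpa using congrFun (congrFun hM a) a
      have : IsEmpty (∀ i, κ i) := ⟨fun x => this.false (x i)⟩
      refine ⟨fun _ => 0, fun κ' _ _ P U _ => ⟨.done, trivial, fun _ ψ χ hψ _ => ?_⟩⟩
      exact (hψ (by simp [Protocol.run, tensorApply, Subsingleton.elim ψ 0])).elim
    choose N hN using fun k => ih k (hnext k)
    -- For party `i` the blocks of all outcomes must fit side by side, hence the sum over branches;
    -- for the other parties this is merely a sufficient bound.
    refine ⟨fun j => m * Fintype.card (κ j) + ∑ k, N k j, fun κ' _ _ P U hf => ?_⟩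
    obtain ⟨Q, U', hQ, hQQ, hsum, hQU⟩ := (hf i).exists_dilation hm hM
    have hf' (k : Fin m) (j : ι) :
        IsFrame (N k j) (Function.update P i (Q k) j) (Function.update U i (U' k) j) := by
      by_cases hj : j = i
      · subst hj; simpa using (hQU k).1
      · simp only [Function.update_of_ne hj]
        exact (hf j).mono ((Finset.single_le_sum (f := fun k => N k j) (fun _ _ => Nat.zero_le _)
          (Finset.mem_univ k)).trans (Nat.le_add_left _ _))
    choose T' hT' hrun using fun k => hN k κ' _ _ (hf' k)
    refine ⟨.measure i m Q T', ⟨hQ, hQQ, hsum, hT'⟩, ?_⟩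
    rintro ⟨k, b'⟩ ψ χ hψ hχ
    simp only [Protocol.run, applyLocal_tensorApply (hQU k).2] at hψ hχ
    obtain ⟨b, hb⟩ := hrun k b' _ _ hψ hχ
    exact ⟨⟨k, b⟩, hb⟩

/-! ### The canonical inclusion into the enlarged space. -/

omit [DecidableEq ι] in
theorem isProductState_extend {ψ : Joint κ} (h : IsProductState ψ) :
    IsProductState (extend (κ' := κ') ψ) := by
  obtain ⟨φ, hφ, rfl⟩ := h
  refine ⟨fun i => WithLp.toLp 2 (Sum.elim (φ i).ofLp 0), fun i => ?_, ?_⟩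
  · have := hφ i
    simp only [EuclideanSpace.norm_eq, Fintype.sum_sum_type] at this ⊢
    simpa using this
  · ext x
    by_cases hx : ∀ i, (x i).isLeft
    · have hl (i) : ∃ a, x i = Sum.inl a := Sum.isLeft_iff.1 (hx i)
      choose a ha using hl
      obtain rfl : x = fun i => Sum.inl (a i) := funext ha
      simp [extend, tensor]
    · simp only [extend, tensor, hx, dif_neg, not_false_eq_true]
      push Not at hx
      obtain ⟨i, hi⟩ := hx
      refine (Finset.prod_eq_zero (Finset.mem_univ i) ?_).symm
      cases h : x i <;> simp_all

theorem inner_extend (ψ χ : Joint κ) :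
    inner ℂ (extend (κ' := κ') ψ) (extend (κ' := κ') χ) = inner ℂ ψ χ := by
  simp only [PiLp.inner_apply]
  symm
  refine Finset.sum_of_injOn (fun x i => Sum.inl (x i)) ?_ (by simp) ?_ ?_
  · intro x _ y _ h
    ext i
    exact Sum.inl_injective (congrFun h i)
  · intro x _ hx
    have : ¬ ∀ i, (x i).isLeft := fun h => hx ⟨fun i => (x i).getLeft (h i), by simp, by simp⟩
    simp [extend, this]
  · intro x _
    simp [extend]

theorem IsOrthogonalProductSet.image_extend {S : Set (Joint κ)} (hS : IsOrthogonalProductSet S) :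
    IsOrthogonalProductSet (extend (κ' := κ') '' S) := by
  refine ⟨?_, ?_⟩
  · rintro _ ⟨ψ, hψ, rfl⟩
    exact isProductState_extend (hS.1 ψ hψ)
  · rintro _ ⟨ψ, hψ, rfl⟩ _ ⟨χ, hχ, rfl⟩ h
    rw [inner_extend]
    exact hS.2 hψ hχ fun e => h (by rw [e])

/-- Identifies the inclusion with the product of isometries from which the simulation starts. -/
theorem tensorApply_inclusion [∀ i, DecidableEq (κ i)] [∀ i, DecidableEq (κ' i)] (ψ : Joint κ) :
    tensorApply (fun i => (1 : Matrix (κ i ⊕ κ' i) (κ i ⊕ κ' i) ℂ).submatrix id Sum.inl) ψ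
      = extend ψ := by
  ext x
  simp only [tensorApply, Matrix.mulVec, dotProduct, tensorOp_apply, Matrix.submatrix_apply, id,
    Matrix.one_apply, Finset.prod_ite_zero, Finset.prod_const_one]
  by_cases hx : ∀ i, (x i).isLeft
  · have hl (i) : ∃ a, x i = Sum.inl a := Sum.isLeft_iff.1 (hx i)
    choose a ha using hl
    obtain rfl : x = fun i => Sum.inl (a i) := funext ha
    simp [extend, ← funext_iff]
  · simp only [extend, hx, dif_neg, not_false_eq_true]
    refine Finset.sum_eq_zero fun y _ => ?_
    rw [if_neg, zero_mul]
    exact fun h => hx fun i => by rw [h i (Finset.mem_univ i)]; rfl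

theorem Protocol.Separates.distinguishes {T : Protocol κ} {S : Set (Joint κ)}
    (h : T.Separates fun ψ : S => (ψ : Joint κ)) : T.Distinguishes S := by
  classical
  -- The value 0 is assigned to records that no state of `S` can produce.
  refine ⟨fun b => if hb : ∃ ψ : S, T.run b ψ ≠ 0 then hb.choose else 0, fun ψ hψ b hb => ?_⟩
  have hb' : T.run b ψ ≠ 0 := by simpa [Protocol.prob] using hb
  have hex : ∃ ψ : S, T.run b ψ ≠ 0 := ⟨⟨ψ, hψ⟩, hb'⟩
  simp only [dif_pos hex]
  rw [h b hex.choose ⟨ψ, hψ⟩ hex.choose_spec hb']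

theorem MeasurableByPOVM.exists_measurableByVonNeumann [∀ i, DecidableEq (κ i)]
    {S : Set (Joint κ)} (hS : MeasurableByPOVM S) : ∃ e : ι → ℕ,
      MeasurableByVonNeumann (extend (κ' := fun i => Fin (e i)) '' S) := by
  obtain ⟨T, hT, hd⟩ := hS
  obtain ⟨e, he⟩ := hT.exists_isVonNeumann
  obtain ⟨T', hVN, hrun⟩ := he (fun i => κ i ⊕ Fin (e i)) (fun _ => 1)
    (fun i => (1 : Matrix (κ i ⊕ Fin (e i)) (κ i ⊕ Fin (e i)) ℂ).submatrix id Sum.inl)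
    -- The whole enlarged space is a frame with `W = 1`: the complement of `ℋ i` has dimension
    -- exactly `e i`.
    (fun i => ⟨e i, le_rfl, 1, by simp, by simp, rfl⟩)
  refine ⟨e, T', hVN, Protocol.Separates.distinguishes ?_⟩
  rintro b' ⟨_, ψ, hψ, rfl⟩ ⟨_, χ, hχ, rfl⟩ h1 h2
  simp only [← tensorApply_inclusion] at h1 h2
  obtain ⟨b, hb1, hb2⟩ := hrun b' ψ χ h1 h2
  have := hd.separates b ⟨ψ, hψ⟩ ⟨χ, hχ⟩ hb1 hb2
  simp only [Subtype.mk.injEq] at this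
  simp only [this]

end

end LocalMeasurement
end

theorem lemma3 (m : ℕ) (d : Fin m → ℕ)
    (S : Set (LocalMeasurement.Joint (fun i => Fin (d i))))
    (hS : LocalMeasurement.IsOrthogonalProductSet S) :
    (LocalMeasurement.MeasurableByVonNeumann S → LocalMeasurement.IsCompletable S) ∧
    (LocalMeasurement.MeasurableByPOVM S →
      ∃ e : Fin m → ℕ,
        LocalMeasurement.IsCompletable
          ((LocalMeasurement.extend (κ' := fun i => Fin (e i))) '' S)) := by
  refine ⟨fun h => h.isCompletable hS, fun h => ?_⟩
  obtain ⟨e, he⟩ := h.exists_measurableByVonNeumann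
  exact ⟨e, he.isCompletable hS.image_extend⟩
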